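/- Let $R$ be an associative ring with unit, not necessarily commutative. An $\mathcal R$-module is an additive covariant functor from left $R$-modules to abelian groups; images of morphisms (natural transformations) of $\mathcal R$-modules are computed pointwise. For a right $R$-module $M$ let $\mathcal M$ be the $\mathcal R$-module $\mathcal M(S)=M\otimes_R S$; in particular $\mathcal R(S)=R\otimes_R S\cong S$. An $\mathcal R$-module is an FP module if it preserves direct limits (colimits over upward directed sets) and direct products of arbitrary families. A right $R$-module $M$ is Mittag-Leffler if for every morphism $f\colon P\to M$ of right $R$-modules with $P$ finitely presented there is a morphism $g\colon P\to Q$ with $Q$ finitely presented such that $\operatorname{Ker}(f\otimes_R N)=\operatorname{Ker}(g\otimes_R N)$ for every left $R$-module $N$. Theorem. Let $M$ be a right $R$-module. The following are equivalent: 1. $M$ is a Mittag-Leffler module. 2. For every $n\in\mathbb N$, the image of every morphism of $\mathcal R$-modules $\mathcal R^n\to\mathcal M$ is an FP module. 3. The image of every morphism of $\mathcal R$-modules $\prod_{\mathbb N}\mathcal R\to\mathcal M$ is an FP module. 4. The image of every morphism of $\mathcal R$-modules $\prod_{\mathbb N}\mathcal R\to\mathcal M$ preserves direct products. -/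

import Mathlib

open CategoryTheory CategoryTheory.Limits
open scoped TensorProduct MulOpposite

universe u

noncomputable section

/-- The subgroup of `M ⊗[ℤ] S` generated by the elements `m r ⊗ s - m ⊗ r s`. -/
def balancedRelations (R M S : Type u) [Ring R] [AddCommGroup M] [Module Rᵐᵒᵖ M]
    [AddCommGroup S] [Module R S] : AddSubgroup (M ⊗[ℤ] S) :=
  AddSubgroup.closure
    {x | ∃ (m : M) (r : R) (s : S), x = (MulOpposite.op r • m) ⊗ₜ[ℤ] s - m ⊗ₜ[ℤ] (r • s)}

/-- The tensor product `M ⊗_R S` of a right module `M` and a left module `S` over a not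
necessarily commutative ring `R`, an abelian group. Right `R`-modules are modules over `Rᵐᵒᵖ`. -/
abbrev TensorOver (R M S : Type u) [Ring R] [AddCommGroup M] [Module Rᵐᵒᵖ M]
    [AddCommGroup S] [Module R S] : Type u :=
  (M ⊗[ℤ] S) ⧸ balancedRelations R M S

/-- The map `f ⊗ g : M ⊗_R S → N ⊗_R T` induced by a morphism `f : M → N` of right modules and a
morphism `g : S → T` of left modules. -/
def TensorOver.map {R M N S T : Type u} [Ring R] [AddCommGroup M] [Module Rᵐᵒᵖ M]
    [AddCommGroup N] [Module Rᵐᵒᵖ N] [AddCommGroup S] [Module R S] [AddCommGroup T] [Module R T]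
    (f : M →ₗ[Rᵐᵒᵖ] N) (g : S →ₗ[R] T) : TensorOver R M S →+ TensorOver R N T :=
  QuotientAddGroup.map (balancedRelations R M S) (balancedRelations R N T)
    (TensorProduct.map f.toAddMonoidHom.toIntLinearMap
      g.toAddMonoidHom.toIntLinearMap).toAddMonoidHom
    (by
      rw [balancedRelations, AddSubgroup.closure_le]
      rintro _ ⟨m, r, s, rfl⟩
      refine AddSubgroup.subset_closure ⟨f m, r, g s, ?_⟩
      simp)

/-- The quasi-coherent functor `S ↦ M ⊗_R S` associated with a right `R`-module `M`. -/
def quasiCoherent (R M : Type u) [Ring R] [AddCommGroup M] [Module Rᵐᵒᵖ M] :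
    ModuleCat.{u} R ⥤ AddCommGrpCat.{u} where
  obj S := AddCommGrpCat.of (TensorOver R M S)
  map g := AddCommGrpCat.ofHom (TensorOver.map LinearMap.id g.hom)
  map_id S := by
    ext x
    induction x using TensorProduct.induction_on with
    | zero => exact map_zero _
    | tmul m s => rfl
    | add x y hx hy => exact (map_add _ _ _).trans (congrArg₂ (· + ·) hx hy)
  map_comp g h := by
    ext x
    induction x using TensorProduct.induction_on with
    | zero => exact (map_zero _).trans (map_zero _).symm
    | tmul m s => rfl
    | add x y hx hy =>
      exact ((map_add _ _ _).trans (congrArg₂ (· + ·) hx hy)).trans (map_add _ _ _).symm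

/-- `F` preserves direct limits, that is, colimits of direct systems indexed by (nonempty)
upward directed sets. -/
def PreservesDirectLimits {R : Type u} [Ring R] (F : ModuleCat.{u} R ⥤ AddCommGrpCat.{u}) :
    Prop :=
  ∀ (I : Type u) [Preorder I] [IsDirectedOrder I] [Nonempty I], PreservesColimitsOfShape I F

/-- `F` preserves direct products of arbitrary families. -/
def PreservesDirectProducts {R : Type u} [Ring R] (F : ModuleCat.{u} R ⥤ AddCommGrpCat.{u}) :
    Prop :=
  ∀ I : Type u, PreservesLimitsOfShape (Discrete I) F

/-- An FP module: an additive functor from left `R`-modules to abelian groups that preserves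
direct limits and direct products. -/
structure IsFPModule {R : Type u} [Ring R] (F : ModuleCat.{u} R ⥤ AddCommGrpCat.{u}) :
    Prop where
  additive : F.Additive
  directLimits : PreservesDirectLimits F
  directProducts : PreservesDirectProducts F

/-- A right `R`-module `M` is Mittag-Leffler if for every morphism `f : P → M` with `P` finitely
presented there are a finitely presented `Q` and a morphism `g : P → Q` such that `f` and `g`
dominate each other: `ker (f ⊗ N) = ker (g ⊗ N)` for every left `R`-module `N`. -/
def IsMittagLeffler (R M : Type u) [Ring R] [AddCommGroup M] [Module Rᵐᵒᵖ M] : Prop :=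
  ∀ (P : Type u) [AddCommGroup P] [Module Rᵐᵒᵖ P] [Module.FinitePresentation Rᵐᵒᵖ P]
    (f : P →ₗ[Rᵐᵒᵖ] M),
    ∃ (Q : Type u) (_ : AddCommGroup Q) (_ : Module Rᵐᵒᵖ Q)
      (_ : Module.FinitePresentation Rᵐᵒᵖ Q) (g : P →ₗ[Rᵐᵒᵖ] Q),
      ∀ (N : Type u) [AddCommGroup N] [Module R N],
        (TensorOver.map f (LinearMap.id : N →ₗ[R] N)).ker =
          (TensorOver.map g (LinearMap.id : N →ₗ[R] N)).ker

/-- The direct product `∏_I 𝓡` in the category of functors, where `𝓡` is the quasi-coherent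
functor associated with the right `R`-module `R`. -/
abbrev ringFunctorPower (R : Type u) [Ring R] (I : Type) [Countable I] :
    ModuleCat.{u} R ⥤ AddCommGrpCat.{u} :=
  ∏ᶜ fun _ : I => quasiCoherent R R

end

/-!
A right module `M` is Mittag-Leffler iff `M ⊗ ∏ S i → ∏ (M ⊗ S i)` is injective for every family
`S`. For `M` Mittag-Leffler this reduces to the case of finitely presented modules. Conversely,
given `f : P → M` with `P` finitely presented, every element of `ker (f ⊗ S)` is killed by `a ⊗ S`
for some factorization `P → Q → M` of `f` with `Q` finitely presented and first factor `a`. If no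
single `a` had `ker (f ⊗ S) ⊆ ker (a ⊗ S)` for all `S`, counterexamples `x a`, one for each
factorization, would lift to one element of `P ⊗ ∏ S a`. It lies in the kernel of
`f ⊗ ∏ S a` by injectivity, hence in that of some `a ⊗ ∏ S a`, contradicting the choice of `x a`.

The image `F` of a morphism `∏ 𝓡 → 𝓜` is a quotient of `S ↦ S^I` and a subfunctor of `M ⊗ -`. The
quotient map makes the comparison maps of `F` for products and direct limits surjective (for direct
limits because, by the Yoneda lemma, the morphism only depends on finitely many coordinates), while
the embedding makes them injective if those of `M ⊗ -` are. Conversely, every element of `M ⊗ ∏ S i`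
lies in the image of some such morphism, so if the images preserve products, then
`M ⊗ ∏ S i → ∏ (M ⊗ S i)` is injective.
-/

universe v w

noncomputable section

namespace TensorOver

variable {R L M N S T : Type u} [Ring R] [AddCommGroup L] [Module Rᵐᵒᵖ L] [AddCommGroup M]
  [Module Rᵐᵒᵖ M] [AddCommGroup N] [Module Rᵐᵒᵖ N]
  [AddCommGroup S] [Module R S] [AddCommGroup T] [Module R T]

variable (R) in
/-- The pure tensor `m ⊗ s` in `M ⊗_R S`, as a biadditive map of `m` and `s`. -/
def tmul : M →+ S →+ TensorOver R M S :=
  AddMonoidHom.mk' (fun m => (QuotientAddGroup.mk' (balancedRelations R M S)).comp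
      (TensorProduct.mk ℤ M S m).toAddMonoidHom)
    (fun m n => by ext s; simp)

theorem op_smul_tmul (r : Rᵐᵒᵖ) (m : M) (s : S) : tmul R (r • m) s = tmul R m (r.unop • s) := by
  rw [← sub_eq_zero]
  exact (QuotientAddGroup.eq_zero_iff _).2 (AddSubgroup.subset_closure ⟨m, r.unop, s, rfl⟩)

@[simp]
theorem map_tmul (f : M →ₗ[Rᵐᵒᵖ] N) (g : S →ₗ[R] T) (m : M) (s : S) :
    map f g (tmul R m s) = tmul R (f m) (g s) := rfl

/-- The homomorphism out of `M ⊗_R S` induced by a balanced biadditive map. -/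
def lift {A : Type*} [AddCommGroup A] (φ : M →+ S →+ A)
    (hφ : ∀ (r : Rᵐᵒᵖ) (m : M) (s : S), φ (r • m) s = φ m (r.unop • s)) : TensorOver R M S →+ A :=
  QuotientAddGroup.lift _ (TensorProduct.liftAddHom φ fun (r : ℤ) m s => by simp) (by
    rw [balancedRelations, AddSubgroup.closure_le]
    rintro _ ⟨m, r, s, rfl⟩
    simp [hφ])

@[simp]
theorem lift_tmul {A : Type*} [AddCommGroup A] (φ : M →+ S →+ A)
    (hφ : ∀ (r : Rᵐᵒᵖ) (m : M) (s : S), φ (r • m) s = φ m (r.unop • s)) (m : M) (s : S) :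
    lift φ hφ (tmul R m s) = φ m s := rfl

@[elab_as_elim]
theorem induction_on {p : TensorOver R M S → Prop} (x : TensorOver R M S) (zero : p 0)
    (tmul : ∀ m s, p (tmul R m s)) (add : ∀ x y, p x → p y → p (x + y)) : p x := by
  induction x using QuotientAddGroup.induction_on with
  | H x =>
    induction x using TensorProduct.induction_on with
    | zero => exact zero
    | tmul m s => exact tmul m s
    | add x y hx hy => exact add _ _ hx hy

theorem addHom_ext {A : Type*} [AddCommGroup A] {φ ψ : TensorOver R M S →+ A}
    (h : ∀ m s, φ (tmul R m s) = ψ (tmul R m s)) : φ = ψ := by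
  refine DFunLike.ext _ _ fun x => ?_
  induction x using induction_on with
  | zero => simp only [map_zero]
  | tmul m s => exact h m s
  | add x y hx hy => rw [map_add, map_add, hx, hy]

theorem map_map {M' S' : Type u} [AddCommGroup M'] [Module Rᵐᵒᵖ M'] [AddCommGroup S']
    [Module R S'] (f : M →ₗ[Rᵐᵒᵖ] N) (g : S →ₗ[R] T) (f' : N →ₗ[Rᵐᵒᵖ] M') (g' : T →ₗ[R] S')
    (x : TensorOver R M S) : map f' g' (map f g x) = map (f' ∘ₗ f) (g' ∘ₗ g) x :=
  DFunLike.congr_fun (addHom_ext fun _ _ => rfl :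
    (map f' g').comp (map f g) = map (f' ∘ₗ f) (g' ∘ₗ g)) x

theorem map_comm (f : M →ₗ[Rᵐᵒᵖ] N) (g : S →ₗ[R] T) (x : TensorOver R M S) :
    map f LinearMap.id (map LinearMap.id g x) = map LinearMap.id g (map f LinearMap.id x) := by
  simp only [map_map, LinearMap.id_comp, LinearMap.comp_id]

theorem map_add_right (f : M →ₗ[Rᵐᵒᵖ] N) (g h : S →ₗ[R] T) :
    map f (g + h) = map f g + map f h :=
  addHom_ext fun m s => by simp

theorem map_zero_left (g : S →ₗ[R] T) : map (0 : M →ₗ[Rᵐᵒᵖ] N) g = 0 :=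
  addHom_ext fun m s => by simp

theorem exists_eq_sum_tmul (x : TensorOver R M S) :
    ∃ (n : ℕ) (m : Fin n → M) (s : Fin n → S), x = ∑ k, tmul R (m k) (s k) := by
  induction x using induction_on with
  | zero => exact ⟨0, 0, 0, by simp⟩
  | tmul m s => exact ⟨1, ![m], ![s], by simp⟩
  | add x y hx hy =>
    obtain ⟨n, m, s, rfl⟩ := hx
    obtain ⟨n', m', s', rfl⟩ := hy
    exact ⟨n + n', Fin.append m m', Fin.append s s', by simp [Fin.sum_univ_add]⟩

theorem exists_eq_sum_tmul_of_span_eq_top {ι : Type*} [Fintype ι] {p : ι → M}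
    (hp : Submodule.span Rᵐᵒᵖ (Set.range p) = ⊤) (x : TensorOver R M S) :
    ∃ s : ι → S, x = ∑ k, tmul R (p k) (s k) := by
  induction x using induction_on with
  | zero => exact ⟨0, by simp⟩
  | tmul m s =>
    obtain ⟨a, rfl⟩ := (Submodule.mem_span_range_iff_exists_fun Rᵐᵒᵖ).1
      (hp ▸ Submodule.mem_top : m ∈ Submodule.span Rᵐᵒᵖ (Set.range p))
    exact ⟨fun k => (a k).unop • s, by simp [op_smul_tmul]⟩
  | add x y hx hy =>
    obtain ⟨s, rfl⟩ := hx
    obtain ⟨t, rfl⟩ := hy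
    exact ⟨s + t, by simp [Finset.sum_add_distrib]⟩

theorem tmul_one_bijective : Function.Bijective (tmul R (1 : R) : S →+ TensorOver R R S) := by
  let μ : TensorOver R R S →+ S := lift (AddMonoidHom.smul) fun r a s => by simp [mul_smul]
  refine Function.bijective_iff_has_inverse.2 ⟨μ, fun s => one_smul R s, fun x => ?_⟩
  induction x using induction_on with
  | zero => simp only [map_zero]
  | tmul a s => simpa [μ] using (op_smul_tmul (MulOpposite.op a) (1 : R) s).symm
  | add x y hx hy => rw [map_add, map_add, hx, hy]

theorem map_surjective {f : M →ₗ[Rᵐᵒᵖ] N} (hf : Function.Surjective f) :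
    Function.Surjective (map f (LinearMap.id : S →ₗ[R] S)) := by
  intro y
  obtain ⟨n, q, s, rfl⟩ := exists_eq_sum_tmul y
  choose m hm using fun k => hf (q k)
  exact ⟨∑ k, tmul R (m k) (s k), by simp [hm]⟩

theorem map_exact {g : L →ₗ[Rᵐᵒᵖ] M} {f : M →ₗ[Rᵐᵒᵖ] N} (hgf : Function.Exact g f)
    (hf : Function.Surjective f) :
    Function.Exact (map g (LinearMap.id : S →ₗ[R] S)) (map f (LinearMap.id : S →ₗ[R] S)) := by
  let A := (map g (LinearMap.id : S →ₗ[R] S)).range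
  let mkA : TensorOver R M S →+ TensorOver R M S ⧸ A := QuotientAddGroup.mk' A
  have mkA_tmul_eq {m m' : M} (h : f m = f m') (s : S) : mkA (tmul R m s) = mkA (tmul R m' s) := by
    obtain ⟨l, hl⟩ := (hgf (m - m')).1 (by rw [map_sub, h, sub_self])
    rw [← sub_eq_zero, ← map_sub, ← AddMonoidHom.sub_apply, ← map_sub, ← hl]
    exact (QuotientAddGroup.eq_zero_iff _).2 ⟨tmul R l s, rfl⟩
  obtain ⟨σ, hσ⟩ := hf.hasRightInverse
  let ψ : TensorOver R N S →+ TensorOver R M S ⧸ A := lift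
    (AddMonoidHom.mk' (fun n => mkA.comp (tmul R (σ n))) fun n n' => by
      ext s
      simpa using mkA_tmul_eq (m' := σ n + σ n') (by simp only [map_add, hσ _]) s)
    (fun r n s => by
      simpa [op_smul_tmul] using mkA_tmul_eq (m' := r • σ n) (by simp only [map_smul, hσ _]) s)
  have ψ_comp : ψ.comp (map f LinearMap.id) = mkA := addHom_ext fun m s => mkA_tmul_eq (hσ _) s
  intro x
  constructor
  · intro hx
    refine (QuotientAddGroup.eq_zero_iff (N := A) x).1 ?_
    exact (DFunLike.congr_fun ψ_comp x).symm.trans ((congrArg ψ hx).trans (map_zero ψ))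
  · rintro ⟨z, rfl⟩
    rw [map_map, hgf.linearMap_comp_eq_zero, map_zero_left, AddMonoidHom.zero_apply]

end TensorOver

section Products

open TensorOver

variable {R M : Type u} [Ring R] [AddCommGroup M] [Module Rᵐᵒᵖ M]

variable (R M) in
/-- The canonical map `M ⊗_R ∏ S i → ∏ (M ⊗_R S i)` is injective for every family `S`. -/
def InjectiveOnProducts : Prop :=
  ∀ (I : Type u) (S : I → Type u) [∀ i, AddCommGroup (S i)] [∀ i, Module R (S i)]
    (x : TensorOver R M (∀ i, S i)),
    (∀ i, map (LinearMap.id : M →ₗ[Rᵐᵒᵖ] M) (LinearMap.proj i) x = 0) → x = 0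

theorem TensorOver.exists_map_proj_eq [Module.Finite Rᵐᵒᵖ M] {I : Type u} {S : I → Type u}
    [∀ i, AddCommGroup (S i)] [∀ i, Module R (S i)] (x : ∀ i, TensorOver R M (S i)) :
    ∃ y : TensorOver R M (∀ i, S i), ∀ i, map LinearMap.id (LinearMap.proj i) y = x i := by
  obtain ⟨n, p, hp⟩ := Module.Finite.exists_fin (R := Rᵐᵒᵖ) (M := M)
  choose s hs using fun i => exists_eq_sum_tmul_of_span_eq_top hp (x i)
  exact ⟨∑ k, tmul R (p k) fun i => s i k, fun i => by simp [hs i]⟩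

theorem injectiveOnProducts_pi (R : Type u) [Ring R] (n : ℕ) :
    InjectiveOnProducts R (Fin n → Rᵐᵒᵖ) := by
  intro I S _ _ x hx
  obtain ⟨s, rfl⟩ := exists_eq_sum_tmul_of_span_eq_top (Pi.basisFun Rᵐᵒᵖ (Fin n)).span_eq x
  suffices ∀ k, s k = 0 by simp [this]
  intro k
  ext i
  refine (tmul_one_bijective (R := R)).injective ?_
  let φ : (Fin n → Rᵐᵒᵖ) →ₗ[Rᵐᵒᵖ] R :=
    (MulOpposite.opLinearEquiv Rᵐᵒᵖ (M := R)).symm.toLinearMap ∘ₗ LinearMap.proj k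
  calc
    tmul R 1 (s k i) = ∑ l, tmul R (φ (Pi.single l 1)) (s l i) := by
      rw [Fintype.sum_eq_single k fun l hl => by simp [φ, Pi.single_eq_of_ne hl.symm]]
      simp [φ]
    _ = tmul R 1 (0 : S i) := by
      simpa using congrArg (map φ LinearMap.id) (hx i)

theorem injectiveOnProducts_of_finitePresentation [Module.FinitePresentation Rᵐᵒᵖ M] :
    InjectiveOnProducts R M := by
  intro I S _ _ x hx
  obtain ⟨n, _, f, g, hf, hgf⟩ := Module.FinitePresentation.exists_fin' Rᵐᵒᵖ M
  obtain ⟨z, rfl⟩ := map_surjective hf x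
  choose w hw using fun i => (map_exact hgf hf (map LinearMap.id (LinearMap.proj i) z)).1
    (by rw [map_comm, hx])
  obtain ⟨v, hv⟩ := exists_map_proj_eq w
  have hz : map g LinearMap.id v = z := by
    refine sub_eq_zero.1 (injectiveOnProducts_pi R n I S _ fun i => ?_)
    rw [map_sub, ← map_comm, hv, hw, sub_self]
  exact (map_exact hgf hf z).2 ⟨v, hz⟩

theorem injectiveOnProducts_of_isMittagLeffler (h : IsMittagLeffler R M) :
    InjectiveOnProducts R M := by
  intro I S _ _ x hx
  obtain ⟨n, m, s, rfl⟩ := exists_eq_sum_tmul x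
  let f : (Fin n → Rᵐᵒᵖ) →ₗ[Rᵐᵒᵖ] M := Fintype.linearCombination Rᵐᵒᵖ m
  let y : TensorOver R (Fin n → Rᵐᵒᵖ) (∀ i, S i) := ∑ k, tmul R (Pi.single k 1) (s k)
  have hy : map f LinearMap.id y = ∑ k, tmul R (m k) (s k) := by
    simp [y, f, Fintype.linearCombination_apply_single]
  obtain ⟨Q, _, _, _, g, ker_eq⟩ := h (Fin n → Rᵐᵒᵖ) f
  rw [← hy] at hx ⊢
  rw [← AddMonoidHom.mem_ker, ker_eq]
  refine injectiveOnProducts_of_finitePresentation I S _ fun i => ?_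
  rw [← map_comm, ← AddMonoidHom.mem_ker, ← ker_eq, AddMonoidHom.mem_ker, map_comm, hx]

end Products

section MittagLeffler

open TensorOver

theorem exists_finitePresentation_of_coprod_eq_zero {A : Type u} {P : Type v} {M : Type w} [Ring A]
    [AddCommGroup P] [Module A P] [Module.FinitePresentation A P] [AddCommGroup M] [Module A M]
    (f : P →ₗ[A] M) {n : ℕ} (k : Fin n → P × (M →₀ A))
    (hk : ∀ j, f.coprod (Finsupp.linearCombination A id) (k j) = 0) :
    ∃ (Q : Type (max u v w)) (_ : AddCommGroup Q) (_ : Module A Q)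
      (_ : Module.FinitePresentation A Q) (q : P × (M →₀ A) →ₗ[A] Q)
      (h : Q →ₗ[A] M),
      h ∘ₗ q ∘ₗ LinearMap.inl A P (M →₀ A) = f ∧ ∀ j, q (k j) = 0 := by
  classical
  let T : Finset M := Finset.univ.biUnion fun j => (k j).2.support
  let ρ : P × (M →₀ A) →ₗ[A] P × (T →₀ A) :=
    LinearMap.id.prodMap (Finsupp.lsubtypeDomain (T : Set M))
  let ψ : P × (T →₀ A) →ₗ[A] M := f.coprod (Finsupp.linearCombination A Subtype.val)
  have ψ_ρ (j : Fin n) : ψ (ρ (k j)) = 0 := by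
    have support_subset : (k j).2.support ⊆ T :=
      Finset.subset_biUnion_of_mem (fun j => (k j).2.support) (Finset.mem_univ j)
    rw [← hk j]
    exact congrArg (f (k j).1 + ·) (Finsupp.sum_subtypeDomain_index
      (h := fun m (a : A) => a • m) fun m hm => support_subset hm)
  let K : Submodule A (P × (T →₀ A)) := Submodule.span A (Set.range fun j => ρ (k j))
  have := Module.finitePresentation_of_projective A (T →₀ A)
  have : Module.FinitePresentation A ((P × (T →₀ A)) ⧸ K) :=
    Module.finitePresentation_of_surjective K.mkQ K.mkQ_surjective
      (by rw [K.ker_mkQ]; exact Submodule.fg_span (Set.finite_range _))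
  refine ⟨_, _, _, this, K.mkQ ∘ₗ ρ,
    K.liftQ ψ (Submodule.span_le.2 (Set.range_subset_iff.2 ψ_ρ)), ?_, fun j => ?_⟩
  · ext p
    simp [ρ, ψ]
  · exact (Submodule.Quotient.mk_eq_zero K).2 (Submodule.subset_span ⟨j, rfl⟩)

variable {R M P S : Type u} [Ring R] [AddCommGroup M] [Module Rᵐᵒᵖ M]
  [AddCommGroup P] [Module Rᵐᵒᵖ P] [AddCommGroup S] [Module R S]

/-- A factorization `P → Q → M` of `f` through a finitely presented module `Q`. Here `Q` is
written as a quotient of a finite free module, so that the factorizations of `f` form a type in the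
universe of `R`, over which products of `R`-modules can be taken. -/
structure FPFactorization (f : P →ₗ[Rᵐᵒᵖ] M) : Type u where
  rank : ℕ
  relations : Submodule Rᵐᵒᵖ (Fin rank → Rᵐᵒᵖ)
  relations_fg : relations.FG
  fst : P →ₗ[Rᵐᵒᵖ] (Fin rank → Rᵐᵒᵖ) ⧸ relations
  snd : ((Fin rank → Rᵐᵒᵖ) ⧸ relations) →ₗ[Rᵐᵒᵖ] M
  snd_comp_fst : snd ∘ₗ fst = f

namespace FPFactorization

variable {f : P →ₗ[Rᵐᵒᵖ] M}

theorem finitePresentation (a : FPFactorization f) :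
    Module.FinitePresentation Rᵐᵒᵖ ((Fin a.rank → Rᵐᵒᵖ) ⧸ a.relations) :=
  Module.finitePresentation_of_surjective _ a.relations.mkQ_surjective
    (by rw [a.relations.ker_mkQ]; exact a.relations_fg)

theorem ker_map_fst_le (a : FPFactorization f) :
    (map a.fst (LinearMap.id : S →ₗ[R] S)).ker ≤ (map f (LinearMap.id : S →ₗ[R] S)).ker := by
  intro x hx
  rw [AddMonoidHom.mem_ker] at hx ⊢
  have := congrArg (map a.snd LinearMap.id) hx
  rwa [map_map, a.snd_comp_fst, map_zero] at this

theorem exists_fst_eq_comp {Q : Type u} [AddCommGroup Q] [Module Rᵐᵒᵖ Q]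
    [Module.FinitePresentation Rᵐᵒᵖ Q] (g : P →ₗ[Rᵐᵒᵖ] Q) (h : Q →ₗ[Rᵐᵒᵖ] M) :
    ∃ (a : FPFactorization (h ∘ₗ g)) (e : Q →ₗ[Rᵐᵒᵖ] (Fin a.rank → Rᵐᵒᵖ) ⧸ a.relations),
      a.fst = e ∘ₗ g := by
  obtain ⟨n, K, e, hK⟩ := Module.FinitePresentation.exists_fin Rᵐᵒᵖ Q
  exact ⟨⟨n, K, hK, e ∘ₗ g, h ∘ₗ e.symm, by ext; simp⟩, e, rfl⟩

theorem exists_map_fst_eq_zero [Module.FinitePresentation Rᵐᵒᵖ P] {x : TensorOver R P S}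
    (hx : map f LinearMap.id x = 0) :
    ∃ a : FPFactorization f, map a.fst LinearMap.id x = 0 := by
  let φ : P × (M →₀ Rᵐᵒᵖ) →ₗ[Rᵐᵒᵖ] M := f.coprod (Finsupp.linearCombination Rᵐᵒᵖ id)
  have φ_surjective : Function.Surjective φ := fun m => ⟨(0, Finsupp.single m 1), by simp [φ]⟩
  obtain ⟨z, hz⟩ := (map_exact (L := LinearMap.ker φ) φ.exact_subtype_ker_map φ_surjective
    (map (LinearMap.inl Rᵐᵒᵖ P (M →₀ Rᵐᵒᵖ)) LinearMap.id x)).1 (by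
      rw [map_map, LinearMap.coprod_inl, LinearMap.id_comp, hx])
  obtain ⟨n, k, s, rfl⟩ := exists_eq_sum_tmul z
  obtain ⟨Q, _, _, _, q, h, rfl, hqk⟩ :=
    exists_finitePresentation_of_coprod_eq_zero f (fun j => (k j).1) fun j => (k j).2
  obtain ⟨a, e, ha⟩ := exists_fst_eq_comp (q ∘ₗ LinearMap.inl Rᵐᵒᵖ P (M →₀ Rᵐᵒᵖ)) h
  refine ⟨a, ?_⟩
  calc
    map a.fst LinearMap.id x =
        map (e ∘ₗ q) LinearMap.id (map (LinearMap.inl _ _ _) LinearMap.id x) := by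
      rw [map_map, ha, LinearMap.comp_assoc, LinearMap.id_comp]
    _ = 0 := by simp [← hz, hqk]

end FPFactorization

theorem isMittagLeffler_of_injectiveOnProducts (h : InjectiveOnProducts R M) :
    IsMittagLeffler R M := by
  intro P _ _ _ f
  suffices ∃ a : FPFactorization f, ∀ (N : Type u) [AddCommGroup N] [Module R N],
      (map f (LinearMap.id : N →ₗ[R] N)).ker ≤ (map a.fst (LinearMap.id : N →ₗ[R] N)).ker by
    obtain ⟨a, ha⟩ := this
    exact ⟨_, _, _, a.finitePresentation, a.fst, fun N _ _ => (ha N).antisymm a.ker_map_fst_le⟩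
  by_contra! hf
  simp only [SetLike.not_le_iff_exists] at hf
  choose N _ _ x hfx hax using hf
  obtain ⟨y, hy⟩ := exists_map_proj_eq x
  have hfy : map f LinearMap.id y = 0 :=
    h _ N _ fun a => by rw [← map_comm, hy]; exact hfx a
  obtain ⟨a, ha⟩ := FPFactorization.exists_map_fst_eq_zero hfy
  refine hax a ?_
  rw [AddMonoidHom.mem_ker, ← hy, map_comm, ha, map_zero]

theorem isMittagLeffler_iff_injectiveOnProducts :
    IsMittagLeffler R M ↔ InjectiveOnProducts R M :=
  ⟨injectiveOnProducts_of_isMittagLeffler, isMittagLeffler_of_injectiveOnProducts⟩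

end MittagLeffler

section LeftAdjoint

open TensorOver

variable {R M S : Type u} [Ring R] [AddCommGroup M] [Module Rᵐᵒᵖ M] [AddCommGroup S] [Module R S]

/-- The left `R`-module structure on homomorphisms out of a right `R`-module `M`, given by
`(r • φ) m = φ (m r)`. -/
abbrev homModule (R M A : Type u) [Ring R] [AddCommGroup M] [Module Rᵐᵒᵖ M] [AddCommGroup A] :
    Module R (M →+ A) :=
  Module.compHom (R := (Rᵐᵒᵖ)ᵈᵐᵃ) (M →+ A) (RingEquiv.opOp R).toRingHom

attribute [local instance] homModule

/-- The tensor-hom adjunction, as a bijection natural in `S` and `A`. -/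
def TensorOver.homEquiv (A : Type u) [AddCommGroup A] :
    (TensorOver R M S →+ A) ≃ (S →ₗ[R] (M →+ A)) where
  toFun φ :=
    { toFun s := φ.comp ((tmul R).flip s)
      map_add' s t := by ext m; simp
      map_smul' r s := by ext m; exact congrArg φ (op_smul_tmul (.op r) m s).symm }
  invFun ψ := lift ψ.toAddMonoidHom.flip fun r m s =>
    (DFunLike.congr_fun (ψ.map_smul r.unop s) m).symm
  left_inv φ := addHom_ext fun m s => rfl
  right_inv ψ := rfl

instance : (quasiCoherent R M).IsLeftAdjoint :=
  (Adjunction.adjunctionOfEquivRight (F := quasiCoherent R M)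
    (G_obj := fun A => ModuleCat.of R (M →+ A))
    (fun _ A =>
      { toFun f := ModuleCat.ofHom (TensorOver.homEquiv A f.hom)
        invFun g := AddCommGrpCat.ofHom ((TensorOver.homEquiv A).symm g.hom)
        left_inv f := congrArg AddCommGrpCat.ofHom ((TensorOver.homEquiv A).left_inv f.hom)
        right_inv g := congrArg ModuleCat.ofHom ((TensorOver.homEquiv A).right_inv g.hom) })
    fun _ _ _ _ _ => rfl).isLeftAdjoint

instance : (quasiCoherent R M).Additive where
  map_add {S T f g} := by
    ext x
    exact DFunLike.congr_fun (map_add_right LinearMap.id f.hom g.hom) x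

end LeftAdjoint

section Functors

variable {C : Type*} [Category C]

theorem additive_of_mono_app {D : Type*} [Preadditive C] [Category D] [Preadditive D]
    {F G : C ⥤ D} [G.Additive] (ι : F ⟶ G) [∀ X, Mono (ι.app X)] : F.Additive where
  map_add {X Y f g} := by
    rw [← cancel_mono (ι.app Y), Preadditive.add_comp, ι.naturality, ι.naturality, ι.naturality,
      G.map_add, Preadditive.comp_add]

theorem injective_of_mono_app {F G : C ⥤ AddCommGrpCat.{u}} (ι : F ⟶ G) [∀ X, Mono (ι.app X)]
    (X : C) : Function.Injective (ι.app X) :=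
  (AddCommGrpCat.mono_iff_injective _).1 inferInstance

theorem nonempty_isLimit_of_bijective {J : Type*} {K : Discrete J ⥤ AddCommGrpCat.{u}}
    (c : Cone K) (h : Function.Bijective fun (x : c.pt) (j : J) => c.π.app ⟨j⟩ x) :
    Nonempty (IsLimit c) := by
  let e : c.pt ≃+ ∀ j : J, K.obj ⟨j⟩ :=
    AddEquiv.ofBijective (AddMonoidHom.pi fun j => (c.π.app ⟨j⟩).hom) h
  refine ⟨{
    lift s := AddCommGrpCat.ofHom
      (e.symm.toAddMonoidHom.comp (AddMonoidHom.pi fun j => (s.π.app ⟨j⟩).hom))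
    fac := fun s ⟨j⟩ => ?_
    uniq := fun s m hm => ?_ }⟩
  · ext x
    exact congrFun (e.apply_symm_apply fun j => s.π.app ⟨j⟩ x) j
  · ext x
    exact (e.eq_symm_apply).2 (funext fun j => ConcreteCategory.congr_hom (hm ⟨j⟩) x)

variable {J : Type u} [SmallCategory J] [IsFiltered J] {K : J ⥤ C}

theorem exists_forall_ι_app_eq {FC : C → C → Type*} {CC : C → Type u}
    [∀ X Y, FunLike (FC X Y) (CC X) (CC Y)] [ConcreteCategory.{u} C FC]
    [PreservesColimit K (forget C)] {c : Cocone K} (hc : IsColimit c) {α : Type*} [Finite α]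
    (s : α → ToType c.pt) :
    ∃ (j : J) (t : α → ToType (K.obj j)), ∀ a, c.ι.app j (t a) = s a := by
  classical
  have := Fintype.ofFinite α
  choose i t ht using fun a => Concrete.isColimit_exists_rep K hc (s a)
  obtain ⟨j, hj⟩ := IsFiltered.sup_objs_exists (Finset.univ.image i)
  let g (a : α) : i a ⟶ j := (hj (Finset.mem_image_of_mem i (Finset.mem_univ a))).some
  exact ⟨j, fun a => K.map (g a) (t a), fun a => by rw [← ht a, c.w_apply]⟩

theorem preservesColimit_of_mono_app {F G : C ⥤ AddCommGrpCat.{u}} (ι : F ⟶ G)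
    [∀ X, Mono (ι.app X)] [PreservesColimit K G] {c : Cocone K} (hc : IsColimit c)
    (hF : ∀ x : F.obj c.pt, ∃ (j : J) (y : F.obj (K.obj j)), F.map (c.ι.app j) y = x) :
    PreservesColimit K F := by
  have : ReflectsColimitsOfShape J (forget AddCommGrpCat.{u}) :=
    reflectsColimitsOfShape_of_reflectsIsomorphisms
  refine preservesColimit_of_preserves_colimit_cocone hc (isColimitOfReflects
    (forget AddCommGrpCat.{u}) (Types.FilteredColimit.isColimitOf _ _ (fun x => ?_) ?_))
  · obtain ⟨j, y, hy⟩ := hF x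
    exact ⟨j, y, hy.symm⟩
  · intro i j x y hxy
    obtain ⟨k, f, g, hfg⟩ := Concrete.isColimit_exists_of_rep_eq (K ⋙ G)
      (isColimitOfPreserves G hc) (ι.app (K.obj i) x) (ι.app (K.obj j) y) (by
        have := congrArg (ι.app c.pt) hxy
        exact ((NatTrans.naturality_apply ι (c.ι.app i) x).symm.trans this).trans
          (NatTrans.naturality_apply ι (c.ι.app j) y))
    refine ⟨k, f, g, injective_of_mono_app ι _ ?_⟩
    exact ((NatTrans.naturality_apply ι (K.map f) x).trans hfg).trans
      (NatTrans.naturality_apply ι (K.map g) y).symm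

end Functors

section Powers

open TensorOver

variable {R M S : Type u} [Ring R] [AddCommGroup M] [Module Rᵐᵒᵖ M] [AddCommGroup S] [Module R S]
  {I : Type}

/-- The functor `S ↦ S^I`, an explicit model of `ringFunctorPower R I`. -/
def powerFunctor (R : Type u) [Ring R] (I : Type) : ModuleCat.{u} R ⥤ AddCommGrpCat.{u} where
  obj S := AddCommGrpCat.of (I → S)
  map g := AddCommGrpCat.ofHom (g.hom.toAddMonoidHom.compLeft I)

/-- The projection `S^I → S ≅ R ⊗_R S`. -/
def powerFunctorProj (R : Type u) [Ring R] (i : I) : powerFunctor R I ⟶ quasiCoherent R R where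
  app S := AddCommGrpCat.ofHom
    ((tmul R (1 : R)).comp (Pi.evalAddMonoidHom (fun _ : I => (S : Type u)) i))

theorem nonempty_isLimit_powerFunctor (R : Type u) [Ring R] (I : Type) :
    Nonempty (IsLimit (Fan.mk (powerFunctor R I) fun i : I => powerFunctorProj R i)) :=
  ⟨evaluationJointlyReflectsLimits _ fun S => (nonempty_isLimit_of_bijective _
    (tmul_one_bijective.comp_left : Function.Bijective fun s : I → S => tmul R (1 : R) ∘ s)).some⟩

/-- `∏_I 𝓡` is the functor `S ↦ S^I`. -/
def powerFunctorIso (R : Type u) [Ring R] (I : Type) [Countable I] :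
    powerFunctor R I ≅ ringFunctorPower R I :=
  (nonempty_isLimit_powerFunctor R I).some.conePointUniqueUpToIso (limit.isLimit _)

/-- The morphism `s ↦ ∑ m i ⊗ s i` from `∏_I 𝓡` to `𝓜`. -/
def powerFunctorHom (m : I →₀ M) : powerFunctor R I ⟶ quasiCoherent R M where
  app S := AddCommGrpCat.ofHom (AddMonoidHom.mk'
    (fun s : I → S => m.sum fun i p => tmul R p (s i)) fun s t => by simp [Finsupp.sum_add])
  naturality S T g := by
    ext s
    exact (map_finsuppSum (TensorOver.map LinearMap.id g.hom) m fun i p => tmul R p (s i)).symm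

theorem powerFunctorHom_app_apply (m : I →₀ M) (s : I → S) :
    (powerFunctorHom m).app (ModuleCat.of R S) s = m.sum fun i p => tmul R p (s i) := rfl

theorem TensorOver.exists_eq_sum_tmul_single (y : TensorOver R M (I →₀ R)) :
    ∃ m : I →₀ M, y = m.sum fun i p => tmul R p (Finsupp.single i 1) := by
  classical
  induction y using TensorOver.induction_on with
  | zero => exact ⟨0, by simp⟩
  | tmul p r =>
    induction r using Finsupp.induction_linear with
    | zero => exact ⟨0, by simp⟩
    | add r r' hr hr' =>
      obtain ⟨m, hm⟩ := hr
      obtain ⟨m', hm'⟩ := hr'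
      exact ⟨m + m', by rw [map_add, hm, hm', Finsupp.sum_add_index' (by simp) (by simp)]⟩
    | single i a =>
      exact ⟨Finsupp.single i (MulOpposite.op a • p), by simp [op_smul_tmul]⟩
  | add x y hx hy =>
    obtain ⟨m, rfl⟩ := hx
    obtain ⟨m', rfl⟩ := hy
    exact ⟨m + m', by rw [Finsupp.sum_add_index' (by simp) (by simp)]⟩

/-- As in the Yoneda lemma, a morphism is determined by the image of the family of unit vectors of
the free module on `I`, since every `s : I → S` is the image of that family under a linear map. -/
theorem powerFunctorHom_surjective :
    Function.Surjective
      (powerFunctorHom : (I →₀ M) → (powerFunctor R I ⟶ quasiCoherent R M)) := by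
  intro f
  let E : ModuleCat.{u} R := ModuleCat.of R (I →₀ R)
  let e : (powerFunctor R I).obj E := fun i : I => Finsupp.single i (1 : R)
  obtain ⟨m, hm⟩ := exists_eq_sum_tmul_single (f.app E e)
  refine ⟨m, ?_⟩
  ext S s
  let φ : E ⟶ S := ModuleCat.ofHom (Finsupp.linearCombination R (s : I → S))
  have map_e : (powerFunctor R I).map φ e = s := funext fun i =>
    (Finsupp.linearCombination_single R (1 : R) i).trans (one_smul R _)
  calc
    (powerFunctorHom m).app S s = (powerFunctorHom m).app S ((powerFunctor R I).map φ e) := by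
      rw [map_e]
    _ = (quasiCoherent R M).map φ ((powerFunctorHom m).app E e) := NatTrans.naturality_apply _ _ _
    _ = (quasiCoherent R M).map φ (f.app E e) := congrArg _ hm.symm
    _ = f.app S ((powerFunctor R I).map φ e) := (NatTrans.naturality_apply _ _ _).symm
    _ = f.app S s := by rw [map_e]

theorem exists_powerFunctor_app_eq_sum_tmul {κ : Type*} [Fintype κ] (j : κ ↪ I) (m : κ → M)
    (s : κ → S) :
    ∃ (f : powerFunctor R I ⟶ quasiCoherent R M) (t : I → S),
      f.app (ModuleCat.of R S) t = ∑ k, tmul R (m k) (s k) := by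
  refine ⟨powerFunctorHom (∑ k, Finsupp.single (j k) (m k)), Function.extend j s 0, ?_⟩
  rw [powerFunctorHom_app_apply, ← Finsupp.sum_finsetSum_index (by simp) (by simp)]
  refine Finset.sum_congr rfl fun k _ => ?_
  rw [Finsupp.sum_single_index (by simp), j.injective.extend_apply]

end Powers

section Images

variable {R M : Type u} [Ring R] [AddCommGroup M] [Module Rᵐᵒᵖ M] {I : Type}
  {F : ModuleCat.{u} R ⥤ AddCommGrpCat.{u}} (e : powerFunctor R I ⟶ F) [∀ S, Epi (e.app S)]
  (ι : F ⟶ quasiCoherent R M) [∀ S, Mono (ι.app S)]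

include e ι in
theorem preservesDirectLimits_of_epi_of_mono : PreservesDirectLimits F := by
  classical
  intro J _ _ _
  refine ⟨fun {K} => ⟨fun {c} hc => ?_⟩⟩
  refine (preservesColimit_of_mono_app ι hc fun x => ?_).preserves hc
  obtain ⟨m, hm⟩ := powerFunctorHom_surjective (e ≫ ι)
  obtain ⟨s : I → c.pt, rfl⟩ := (AddCommGrpCat.epi_iff_surjective (e.app c.pt)).1 inferInstance x
  obtain ⟨j, t, ht⟩ := exists_forall_ι_app_eq hc fun i : m.support => s i
  let t' : I → K.obj j := fun i => if hi : i ∈ m.support then t ⟨i, hi⟩ else 0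
  have app_t' : ∀ i ∈ m.support, c.ι.app j (t' i) = s i := fun i hi => by
    simp only [t', dif_pos hi]
    exact ht ⟨i, hi⟩
  refine ⟨j, e.app _ t', injective_of_mono_app ι _ ?_⟩
  calc
    ι.app c.pt (F.map (c.ι.app j) (e.app _ t')) =
        (e ≫ ι).app c.pt ((powerFunctor R I).map (c.ι.app j) t') :=
      congrArg (ι.app c.pt) (NatTrans.naturality_apply e (c.ι.app j) t').symm
    _ = (e ≫ ι).app c.pt s := by
      rw [← hm]
      exact Finset.sum_congr rfl fun i hi => congrArg (TensorOver.tmul R (m i)) (app_t' i hi)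

include e ι in
theorem preservesDirectProducts_of_epi_of_mono (h : InjectiveOnProducts R M) :
    PreservesDirectProducts F := by
  intro J
  have (S : J → ModuleCat.{u} R) : PreservesLimit (Discrete.functor S) F := by
    let P := ModuleCat.of R (∀ j, S j)
    let π (j : J) : P ⟶ S j := ModuleCat.ofHom (LinearMap.proj j)
    refine preservesLimit_of_preserves_limit_cone (ModuleCat.productConeIsLimit S)
      (nonempty_isLimit_of_bijective _ ⟨?_, fun y => ?_⟩).some
    · let φ : F.obj P →+ ∀ j, F.obj (S j) := AddMonoidHom.pi fun j => (F.map (π j)).hom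
      refine (injective_iff_map_eq_zero φ).2 fun x hx => injective_of_mono_app ι _ ?_
      rw [map_zero]
      refine h J (fun j => S j) _ fun j => ?_
      exact (NatTrans.naturality_apply ι (π j) x).symm.trans
        ((congrArg (ι.app (S j)) (congrFun hx j)).trans (map_zero _))
    · have e_surjective (j : J) : Function.Surjective (e.app (S j)) :=
        (AddCommGrpCat.epi_iff_surjective _).1 inferInstance
      choose s hs using fun j => e_surjective j (y j)
      refine ⟨e.app P fun i j => s j i, funext fun j => ?_⟩
      exact (NatTrans.naturality_apply e (π j) _).symm.trans (hs j)
  exact preservesLimitsOfShape_of_discrete F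

theorem eq_zero_of_preservesDirectProducts (hF : PreservesDirectProducts F) {J : Type u}
    {S : J → Type u} [∀ j, AddCommGroup (S j)] [∀ j, Module R (S j)]
    (x : F.obj (ModuleCat.of R (∀ j, S j)))
    (hx : ∀ j, TensorOver.map LinearMap.id (LinearMap.proj j) (ι.app _ x) = 0) : x = 0 := by
  have := hF J
  have map_proj_eq_zero (j : J) : F.map (ModuleCat.ofHom (LinearMap.proj j)) x = 0 :=
    injective_of_mono_app ι (ModuleCat.of R (S j))
      ((NatTrans.naturality_apply ι _ x).trans ((hx j).trans (map_zero _).symm))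
  exact Concrete.isLimit_ext _ (isLimitOfPreserves F (ModuleCat.productConeIsLimit fun j =>
    ModuleCat.of R (S j))) _ _ fun ⟨j⟩ => (map_proj_eq_zero j).trans (map_zero _).symm

theorem isFPModule_image (h : IsMittagLeffler R M) [Countable I]
    (f : ringFunctorPower R I ⟶ quasiCoherent R M) : IsFPModule (image f) :=
  let e : powerFunctor R I ⟶ image f := (powerFunctorIso R I).hom ≫ factorThruImage f
  { additive := additive_of_mono_app (image.ι f)
    directLimits := preservesDirectLimits_of_epi_of_mono e (image.ι f)
    directProducts := preservesDirectProducts_of_epi_of_mono e (image.ι f)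
      (isMittagLeffler_iff_injectiveOnProducts.1 h) }

theorem isMittagLeffler_of_preservesDirectProducts_image
    (h : ∀ n : ℕ, ∃ (I : Type) (_ : Countable I) (_ : Fin n ↪ I),
      ∀ f : ringFunctorPower R I ⟶ quasiCoherent R M, PreservesDirectProducts (image f)) :
    IsMittagLeffler R M := by
  refine isMittagLeffler_iff_injectiveOnProducts.2 fun J S _ _ x hx => ?_
  obtain ⟨n, m, s, rfl⟩ := TensorOver.exists_eq_sum_tmul x
  obtain ⟨I, _, j, hI⟩ := h n
  obtain ⟨f, t, hft⟩ := exists_powerFunctor_app_eq_sum_tmul (R := R) j m s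
  let g : ringFunctorPower R I ⟶ quasiCoherent R M := (powerFunctorIso R I).inv ≫ f
  let e : powerFunctor R I ⟶ image g := (powerFunctorIso R I).hom ≫ factorThruImage g
  have e_comp_ι : e ≫ image.ι g = f := by simp [e, g]
  rw [← hft, ← e_comp_ι] at hx ⊢
  have e_t_eq_zero := eq_zero_of_preservesDirectProducts (S := S) (image.ι g) (hI g) (e.app _ t) hx
  exact (congrArg ((image.ι g).app _) e_t_eq_zero).trans (map_zero _)

end Images

end

theorem mainTheorem6 (R : Type u) [Ring R] (M : Type u) [AddCommGroup M] [Module Rᵐᵒᵖ M] :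
    (IsMittagLeffler R M ↔
      ∀ (n : ℕ) (f : ringFunctorPower R (Fin n) ⟶ quasiCoherent R M), IsFPModule (image f)) ∧
    (IsMittagLeffler R M ↔
      ∀ f : ringFunctorPower R ℕ ⟶ quasiCoherent R M, IsFPModule (image f)) ∧
    (IsMittagLeffler R M ↔
      ∀ f : ringFunctorPower R ℕ ⟶ quasiCoherent R M, PreservesDirectProducts (image f)) := by
  have of_fin (h : ∀ (n : ℕ) (f : ringFunctorPower R (Fin n) ⟶ quasiCoherent R M),
      PreservesDirectProducts (image f)) : IsMittagLeffler R M :=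
    isMittagLeffler_of_preservesDirectProducts_image fun n =>
      ⟨Fin n, inferInstance, Function.Embedding.refl _, h n⟩
  have of_nat (h : ∀ f : ringFunctorPower R ℕ ⟶ quasiCoherent R M,
      PreservesDirectProducts (image f)) : IsMittagLeffler R M :=
    isMittagLeffler_of_preservesDirectProducts_image fun _ =>
      ⟨ℕ, inferInstance, Fin.valEmbedding, h⟩
  exact ⟨⟨fun h _ f => isFPModule_image h f, fun h => of_fin fun n f => (h n f).directProducts⟩,
    ⟨fun h f => isFPModule_image h f, fun h => of_nat fun f => (h f).directProducts⟩,
    ⟨fun h f => (isFPModule_image h f).directProducts, of_nat⟩⟩
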